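/- Let $H_\nu(x,y,\tau)$, $0<\nu<\nu^*\le\infty$, be a family of Hamiltonians on $\mathbb R^2$, of class $C^2$ in all variables (in particular, of class $C^r$, $r>2$) and $2\pi$-periodic in $\tau$, and let $\omega(\nu)>0$. Let $F=F_\nu$ be the Poincaré map of $\dot x=\partial_yH_\nu(x,y,\omega(\nu)t)$, $\dot y=-\partial_xH_\nu(x,y,\omega(\nu)t)$, i.e. the map from time $0$ to time $2\pi/\omega(\nu)$, and let $\gamma=\gamma(\nu)$ be a hyperbolic fixed point of $F$. Fix a branch of the unstable manifold and a branch of the stable manifold of $\gamma$ (each invariant under $F^{-1}$, respectively $F$, and parametrized injectively by $[0,\infty)$ starting at $\gamma$). For points $a,b$ of the unstable (stable) branch, let $U(a,b)$, $U[a,b]$ ($S(a,b)$, $S[a,b]$) be the open and the closed segment of that branch between $a$ and $b$. A point $p\ne\gamma$ on both branches is a *primary homoclinic point* if $U(\gamma,p)\cap S(\gamma,p)=\emptyset$. A curve has a *topologically transverse* intersection with a set $\Gamma$ at a point if in some local topological chart $\Gamma$ is a straight line and the curve passes there from one side of it to the other; $A\pitchfork_T\Gamma$ is the set of such points on the open segment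 $A$. Let $P(\nu)$ be the set of primary homoclinic points at which the two branches intersect topologically transversely. A primary homoclinic point at which they do not is said to undergo a primary homoclinic bifurcation at $\nu$. For $p\in P(\nu)$ put $\partial R^{p}=U[\gamma,p]\cup S[\gamma,p]$, and let $R^{p}$ be the open region enclosed by $\partial R^p$ and $\overline{R}^{p}=R^{p}\cup\partial R^{p}$. Let $p=p_0^{r_j}$ and $q=p_0^{r_{j+1}}$ be neighbouring points of $P(\nu)$: $p$ precedes $q$ on the unstable branch, and no point of $P(\nu)$ lies in $U(p,q)$. Assume that no point of $U(p,q)$ undergoes a primary homoclinic bifurcation at $\nu$ (this holds for all neighbours if $\nu$ is not a primary homoclinic bifurcation value). Then 1. either $U(p,q)\subset R^{p}$ or $U(p,q)\cap \overline{R}^{p}=\emptyset$, and $U(p,q)\pitchfork_T\partial R^{p}=\emptyset$; 2. either $S(q,p)\subset R^{q}$ or $S(q,p)\cap \overline{R}^{q}=\emptyset$, and $S(q,p)\pitchfork_T\partial R^{q}=\emptyset$; 3. $U(p,q)\pitchfork_T S(q,p)=\emptyset$. -/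

import Mathlib

open Set Filter Topology

/-! ### Periodically forced Hamiltonian systems and their Poincare map -/

/-- The Hamiltonian vector field `(∂H/∂y, -∂H/∂x)` of `H (x, y) τ`, where `τ` is the phase. -/
noncomputable def hamiltonianField (H : ℝ × ℝ → ℝ → ℝ) (z : ℝ × ℝ) (τ : ℝ) : ℝ × ℝ :=
  (deriv (fun y => H (z.1, y) τ) z.2, -deriv (fun x => H (x, z.2) τ) z.1)

/-- The graph of the time-`2π/ω` map `F` of the flow of `H(x, y, ω t)`: `F z = w`.
It is a relation, since solutions may blow up before time `2π/ω`, where `F` is then not defined. -/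
def PoincareMap (H : ℝ × ℝ → ℝ → ℝ) (ω : ℝ) (z w : ℝ × ℝ) : Prop :=
  ∃ c : ℝ → ℝ × ℝ, c 0 = z ∧ c (2 * Real.pi / ω) = w ∧
    ∀ t ∈ Icc 0 (2 * Real.pi / ω),
      HasDerivWithinAt c (hamiltonianField H (c t) (ω * t)) (Icc 0 (2 * Real.pi / ω)) t

/-- `g` is a hyperbolic (saddle) fixed point of the Poincare map: the map is defined near `g`,
fixes `g`, and its differential at `g` has an eigenvalue outside and one inside
the unit circle. -/
def IsHyperbolicFixedPoint (H : ℝ × ℝ → ℝ → ℝ) (ω : ℝ) (g : ℝ × ℝ) : Prop :=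
  ∃ (F : ℝ × ℝ → ℝ × ℝ) (A : ℝ × ℝ →L[ℝ] ℝ × ℝ) (l m : ℝ),
    (∀ᶠ z in 𝓝 g, PoincareMap H ω z (F z)) ∧ F g = g ∧ HasFDerivAt F A g ∧
    1 < |l| ∧ 0 < |m| ∧ |m| < 1 ∧
    (∃ v, v ≠ 0 ∧ A v = l • v) ∧ (∃ v, v ≠ 0 ∧ A v = m • v)

/-- `u : [0, ∞) → ℝ²` parametrizes injectively a branch of the unstable manifold of `g`, starting
at `g`: every point of the branch is the image under the Poincare map of a point of the branch
closer to `g`; hence the backward orbits tend to `g` inside the branch. (If solutions blow up, the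
branch may be only an initial piece, reparametrized; if the Poincare map is globally defined, the
complete branch is allowed, as is every initial piece of it.) -/
structure IsUnstableBranch (H : ℝ × ℝ → ℝ → ℝ) (ω : ℝ) (g : ℝ × ℝ) (u : ℝ → ℝ × ℝ) : Prop where
  continuousOn : ContinuousOn u (Ici 0)
  injOn : InjOn u (Ici 0)
  start : u 0 = g
  invariant : ∀ t, 0 < t → ∃ t', 0 < t' ∧ t' < t ∧ PoincareMap H ω (u t') (u t)

/-- The same for the stable manifold: the Poincare map sends every point of the branch to a
point of the branch closer to `g`. -/
structure IsStableBranch (H : ℝ × ℝ → ℝ → ℝ) (ω : ℝ) (g : ℝ × ℝ) (s : ℝ → ℝ × ℝ) : Prop where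
  continuousOn : ContinuousOn s (Ici 0)
  injOn : InjOn s (Ici 0)
  start : s 0 = g
  invariant : ∀ t, 0 < t → ∃ t', 0 < t' ∧ t' < t ∧ PoincareMap H ω (s t) (s t')

/-- A family, with parameter `0 < ν < νstar ≤ ∞`, of Hamiltonians `H ν (x, y) τ`, `2π`-periodic in
the phase `τ = ω(ν) t`, with frequency `ω ν`, a hyperbolic periodic orbit through `γ ν`, and
a chosen unstable branch `u ν` and stable branch `s ν` of `γ ν`. -/
structure IsForcedFamily (νstar : EReal) (H : ℝ → ℝ × ℝ → ℝ → ℝ) (ω : ℝ → ℝ) (γ : ℝ → ℝ × ℝ)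
    (u s : ℝ → ℝ → ℝ × ℝ) : Prop where
  smooth : ContDiffOn ℝ 2 (fun q : ℝ × (ℝ × ℝ) × ℝ => H q.1 q.2.1 q.2.2)
    {q | 0 < q.1 ∧ (q.1 : EReal) < νstar}
  periodic : ∀ ν : ℝ, 0 < ν → (ν : EReal) < νstar →
    ∀ z τ, H ν z (τ + 2 * Real.pi) = H ν z τ
  frequency_pos : ∀ ν : ℝ, 0 < ν → (ν : EReal) < νstar → 0 < ω ν
  hyperbolic : ∀ ν : ℝ, 0 < ν → (ν : EReal) < νstar → IsHyperbolicFixedPoint (H ν) (ω ν) (γ ν)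
  unstable : ∀ ν : ℝ, 0 < ν → (ν : EReal) < νstar → IsUnstableBranch (H ν) (ω ν) (γ ν) (u ν)
  stable : ∀ ν : ℝ, 0 < ν → (ν : EReal) < νstar → IsStableBranch (H ν) (ω ν) (γ ν) (s ν)

/-! ### Segments, regions, topologically transverse intersections -/

/-- The parameters `t` strictly between those of the points `p`, `q` of the ray `c`
(in either order). -/
def openParams (c : ℝ → ℝ × ℝ) (p q : ℝ × ℝ) : Set ℝ :=
  {t | ∃ a b, 0 ≤ a ∧ 0 ≤ b ∧ c a = p ∧ c b = q ∧ min a b < t ∧ t < max a b}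

/-- The parameters `t` between those of the points `p`, `q` of the ray `c`, inclusive. -/
def closedParams (c : ℝ → ℝ × ℝ) (p q : ℝ × ℝ) : Set ℝ :=
  {t | ∃ a b, 0 ≤ a ∧ 0 ≤ b ∧ c a = p ∧ c b = q ∧ min a b ≤ t ∧ t ≤ max a b}

/-- The open segment `C(p, q)` of the ray `c`. -/
def openSegmentOf (c : ℝ → ℝ × ℝ) (p q : ℝ × ℝ) : Set (ℝ × ℝ) := c '' openParams c p q

/-- The closed segment `C[p, q]` of the ray `c`. -/
def closedSegmentOf (c : ℝ → ℝ × ℝ) (p q : ℝ × ℝ) : Set (ℝ × ℝ) := c '' closedParams c p q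

/-- The curve `c` crosses the set `Γ` at the parameter `a`: in some local topological chart around
`c a` the set `Γ` is the horizontal axis, and `c` passes at `a` from one of its sides
to the other one. -/
def CrossesAt (c : ℝ → ℝ × ℝ) (a : ℝ) (Γ : Set (ℝ × ℝ)) : Prop :=
  ∃ φ : OpenPartialHomeomorph (ℝ × ℝ) (ℝ × ℝ),
    c a ∈ φ.source ∧ c a ∈ Γ ∧ (∀ z ∈ φ.source, z ∈ Γ ↔ (φ z).2 = 0) ∧
    (((∀ᶠ t in 𝓝[<] a, c t ∈ φ.source ∧ 0 < (φ (c t)).2) ∧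
        (∀ᶠ t in 𝓝[>] a, c t ∈ φ.source ∧ (φ (c t)).2 < 0)) ∨
     ((∀ᶠ t in 𝓝[<] a, c t ∈ φ.source ∧ (φ (c t)).2 < 0) ∧
        (∀ᶠ t in 𝓝[>] a, c t ∈ φ.source ∧ 0 < (φ (c t)).2)))

/-- The set `C(p, q) ⋔_T Γ` of topologically transverse intersections of an open segment of
the ray `c` with the set `Γ`. -/
def transverseIntersection (c : ℝ → ℝ × ℝ) (p q : ℝ × ℝ) (Γ : Set (ℝ × ℝ)) : Set (ℝ × ℝ) :=
  {z | ∃ t ∈ openParams c p q, c t = z ∧ CrossesAt c t Γ}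

/-- The boundary `U[g, p] ∪ S[g, p]` of the region defined by `p`. -/
def regionBoundary (u s : ℝ → ℝ × ℝ) (g p : ℝ × ℝ) : Set (ℝ × ℝ) :=
  closedSegmentOf u g p ∪ closedSegmentOf s g p

/-- The open region enclosed by `Γ`: the union of the bounded components of its complement. -/
def enclosedBy (Γ : Set (ℝ × ℝ)) : Set (ℝ × ℝ) :=
  {z | z ∉ Γ ∧ Bornology.IsBounded (connectedComponentIn Γᶜ z)}

/-! ### Primary homoclinic points -/

/-- `p` is a primary homoclinic point: it is on both branches, is not the fixed point `g`, and
the open segments `U(g, p)` and `S(g, p)` do not intersect. -/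
def IsPrimaryHomoclinic (u s : ℝ → ℝ × ℝ) (g p : ℝ × ℝ) : Prop :=
  p ∈ u '' Ioi 0 ∧ p ∈ s '' Ioi 0 ∧ openSegmentOf u g p ∩ openSegmentOf s g p = ∅

/-- The unstable branch crosses the stable branch (a short arc of it) at `p`. -/
def IsTopTransverse (u s : ℝ → ℝ × ℝ) (p : ℝ × ℝ) : Prop :=
  ∃ a b ε : ℝ, 0 < a ∧ 0 < ε ∧ ε < b ∧ u a = p ∧ s b = p ∧
    CrossesAt u a (s '' Ioo (b - ε) (b + ε))

/-- The set `P` of topologically transverse primary homoclinic points. -/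
def transversePrimary (u s : ℝ → ℝ × ℝ) (g : ℝ × ℝ) : Set (ℝ × ℝ) :=
  {p | IsPrimaryHomoclinic u s g p ∧ IsTopTransverse u s p}

/-- `p` and `q` are neighbours in `P`, with `p` before `q` in the unstable ordering: no other point
of `P` (on any of the orbits) is between them on the unstable branch. -/
def AreNeighbours (u s : ℝ → ℝ × ℝ) (g p q : ℝ × ℝ) : Prop :=
  p ∈ transversePrimary u s g ∧ q ∈ transversePrimary u s g ∧
  (∃ a b, 0 < a ∧ a < b ∧ u a = p ∧ u b = q) ∧
  ∀ z ∈ transversePrimary u s g, z ∉ openSegmentOf u p q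

/-- The primary homoclinic point `z` undergoes a homoclinic bifurcation at the current parameter
value: it is a tangency of the two branches which is not topologically transverse. -/
def UndergoesPrimaryBifurcation (u s : ℝ → ℝ × ℝ) (g z : ℝ × ℝ) : Prop :=
  IsPrimaryHomoclinic u s g z ∧ ¬ IsTopTransverse u s z

/-!
Homoclinic points are recorded by their parameters: pairs `(t, τ)` with `u t = s τ`. Since the
branches are injective, such a point is primary exactly when no homoclinic pair with positive
parameters is smaller in both coordinates (`isPrimaryHomoclinic_iff`).

Let `p = u a = s b` and `q = u a' = s b'` with `a < a'`. As `q` is primary, `b' < b`. Suppose that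
`U(p, q)` met `S(q, p)`, at parameters `(t₀, τ₀)`. Every homoclinic pair below `(t₀, τ₀)` with
positive parameters lies in the rectangle `[a, t₀] × [b', τ₀]`, because `p` and `q` are primary. By
compactness there is one with smallest first coordinate; it is primary and lies on `U(p, q)`. The
hypotheses exclude this: it would be either a point of `P` between the neighbours `p` and `q` or a
primary bifurcation. Hence `U(p, q)` and `S(q, p)` are disjoint (`ne_of_no_primary_between`).

Primarity of `p` and `q` excludes the remaining intersections, so `U(p, q)` misses `∂R^p` and
`S(q, p)` misses `∂R^q`. A connected set missing `Γ` lies in one component of the complement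
of `Γ`, so it is either enclosed by `Γ` or disjoint from the closed region
(`subset_enclosedBy_or_inter_eq_empty`).
-/

lemma openParams_eq {c : ℝ → ℝ × ℝ} (hc : InjOn c (Ici 0)) {a b : ℝ} (ha : 0 ≤ a) (hb : 0 ≤ b) :
    openParams c (c a) (c b) = Ioo (min a b) (max a b) := by
  ext t
  constructor
  · rintro ⟨a', b', ha', hb', h1, h2, h3, h4⟩
    obtain rfl := hc ha' ha h1
    obtain rfl := hc hb' hb h2
    exact ⟨h3, h4⟩
  · rintro ⟨h3, h4⟩
    exact ⟨a, b, ha, hb, rfl, rfl, h3, h4⟩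

lemma closedParams_eq {c : ℝ → ℝ × ℝ} (hc : InjOn c (Ici 0)) {a b : ℝ} (ha : 0 ≤ a) (hb : 0 ≤ b) :
    closedParams c (c a) (c b) = Icc (min a b) (max a b) := by
  ext t
  constructor
  · rintro ⟨a', b', ha', hb', h1, h2, h3, h4⟩
    obtain rfl := hc ha' ha h1
    obtain rfl := hc hb' hb h2
    exact ⟨h3, h4⟩
  · rintro ⟨h3, h4⟩
    exact ⟨a, b, ha, hb, rfl, rfl, h3, h4⟩

lemma openSegmentOf_eq {c : ℝ → ℝ × ℝ} (hc : InjOn c (Ici 0)) {a b : ℝ} (ha : 0 ≤ a)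
    (hab : a ≤ b) : openSegmentOf c (c a) (c b) = c '' Ioo a b := by
  rw [openSegmentOf, openParams_eq hc ha (ha.trans hab), min_eq_left hab, max_eq_right hab]

lemma closedSegmentOf_eq {c : ℝ → ℝ × ℝ} (hc : InjOn c (Ici 0)) {a b : ℝ} (ha : 0 ≤ a)
    (hab : a ≤ b) : closedSegmentOf c (c a) (c b) = c '' Icc a b := by
  rw [closedSegmentOf, closedParams_eq hc ha (ha.trans hab), min_eq_left hab, max_eq_right hab]

/-- The intersections counted by `transverseIntersection` lie in the set itself, so there are none
if the open segment misses it. -/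
lemma transverseIntersection_eq_empty {c : ℝ → ℝ × ℝ} {p q : ℝ × ℝ} {Γ : Set (ℝ × ℝ)}
    (h : Disjoint (openSegmentOf c p q) Γ) : transverseIntersection c p q Γ = ∅ := by
  rw [eq_empty_iff_forall_notMem]
  rintro z ⟨t, ht, rfl, φ, -, hΓ, -⟩
  exact disjoint_left.1 h ⟨t, ht, rfl⟩ hΓ

lemma subset_enclosedBy_or_inter_eq_empty {A Γ : Set (ℝ × ℝ)} (hA : IsPreconnected A)
    (h : Disjoint A Γ) : A ⊆ enclosedBy Γ ∨ A ∩ (Γ ∪ enclosedBy Γ) = ∅ := by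
  have hsub : A ⊆ Γᶜ := h.subset_compl_right
  rcases (A ∩ enclosedBy Γ).eq_empty_or_nonempty with h0 | ⟨z, hz, hz'⟩
  · right
    rw [inter_union_distrib_left, h0, h.inter_eq, union_empty]
  · left
    intro w hw
    have hmem : w ∈ connectedComponentIn Γᶜ z := hA.subset_connectedComponentIn hz hsub hw
    exact ⟨hsub hw, connectedComponentIn_eq hmem ▸ hz'.2⟩

lemma isPrimaryHomoclinic_iff {u s : ℝ → ℝ × ℝ} (hu : InjOn u (Ici 0)) (hs : InjOn s (Ici 0))
    (h0 : u 0 = s 0) {a b : ℝ} (ha : 0 < a) (hb : 0 < b) (hab : u a = s b) :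
    IsPrimaryHomoclinic u s (u 0) (u a) ↔
      ∀ t ∈ Ioo 0 a, ∀ τ ∈ Ioo 0 b, u t ≠ s τ := by
  have hseg : openSegmentOf s (u 0) (u a) = s '' Ioo 0 b := by
    rw [h0, hab, openSegmentOf_eq hs le_rfl hb.le]
  rw [IsPrimaryHomoclinic, hseg, openSegmentOf_eq hu le_rfl ha.le]
  constructor
  · rintro ⟨-, -, h⟩ t ht τ hτ heq
    exact eq_empty_iff_forall_notMem.1 h (u t) ⟨⟨t, ht, rfl⟩, ⟨τ, hτ, heq.symm⟩⟩
  · intro h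
    refine ⟨⟨a, ha, rfl⟩, ⟨b, hb, hab.symm⟩, eq_empty_iff_forall_notMem.2 ?_⟩
    rintro _ ⟨⟨t, ht, rfl⟩, ⟨τ, hτ, heq⟩⟩
    exact h t ht τ hτ heq.symm

/-- If no homoclinic point on the arc `u (a, a')` is primary, then this arc misses the arc
`s (b', b)`: a homoclinic pair in the open rectangle would yield one with smallest first coordinate
among those below it, and that one would be primary. -/
lemma ne_of_no_primary_between {u s : ℝ → ℝ × ℝ}
    (hs : InjOn s (Ici 0)) (huc : ContinuousOn u (Ici 0))
    (hsc : ContinuousOn s (Ici 0))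
    {a a' b b' : ℝ} (ha : 0 < a) (hb' : 0 < b') (hp : u a = s b)
    (hpp : ∀ t ∈ Ioo 0 a, ∀ τ ∈ Ioo 0 b, u t ≠ s τ)
    (hqq : ∀ t ∈ Ioo 0 a', ∀ τ ∈ Ioo 0 b', u t ≠ s τ)
    (hno : ∀ t ∈ Ioo a a', ∀ τ, 0 < τ → u t = s τ →
      ∃ t' ∈ Ioo 0 t, ∃ τ' ∈ Ioo 0 τ, u t' = s τ') :
    ∀ t ∈ Ioo a a', ∀ τ ∈ Ioo b' b, u t ≠ s τ := by
  intro t₀ ht₀ τ₀ hτ₀ h₀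
  let K : Set (ℝ × ℝ) := (Icc a t₀ ×ˢ Icc b' τ₀) ∩ (fun x => u x.1 - s x.2) ⁻¹' {0}
  have hcont : ContinuousOn (fun x : ℝ × ℝ => u x.1 - s x.2) (Icc a t₀ ×ˢ Icc b' τ₀) :=
    (huc.comp continuousOn_fst fun x hx => ha.le.trans hx.1.1).sub
      (hsc.comp continuousOn_snd fun x hx => hb'.le.trans hx.2.1)
  have hcompact : IsCompact K :=
    (isCompact_Icc.prod isCompact_Icc).of_isClosed_subset
      (hcont.preimage_isClosed_of_isClosed (isClosed_Icc.prod isClosed_Icc) isClosed_singleton)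
      inter_subset_left
  obtain ⟨⟨t, τ⟩, ⟨⟨⟨hat, htt⟩, hbτ, hττ⟩, heq⟩, hmin⟩ :=
    hcompact.exists_isMinOn
      ⟨(t₀, τ₀), ⟨⟨ht₀.1.le, le_rfl⟩, hτ₀.1.le, le_rfl⟩, sub_eq_zero.2 h₀⟩
      continuous_fst.continuousOn
  simp only at hat htt hbτ hττ
  replace heq : u t = s τ := sub_eq_zero.1 heq
  have hne : a ≠ t := by
    rintro rfl
    have := hs (hb'.le.trans hbτ) (hb'.trans (hτ₀.1.trans hτ₀.2)).le (heq.symm.trans hp)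
    linarith [hτ₀.2]
  obtain ⟨t', ht', τ', hτ', h'⟩ :=
    hno t ⟨lt_of_le_of_ne hat hne, htt.trans_lt ht₀.2⟩ τ (hb'.trans_le hbτ) heq
  have hτb : τ' < b := hτ'.2.trans_le (hττ.trans hτ₀.2.le)
  have hta : t' < a' := ht'.2.trans_le (htt.trans ht₀.2.le)
  -- Primarity of `p` and `q` confines the smaller homoclinic pair to the rectangle.
  have hat' : a ≤ t' := not_lt.1 fun h => hpp t' ⟨ht'.1, h⟩ τ' ⟨hτ'.1, hτb⟩ h'
  have hbτ' : b' ≤ τ' := not_lt.1 fun h => hqq t' ⟨ht'.1, hta⟩ τ' ⟨hτ'.1, h⟩ h'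
  have hle : t ≤ t' := hmin (show (t', τ') ∈ K from
    ⟨⟨⟨hat', ht'.2.le.trans htt⟩, hbτ', hτ'.2.le.trans hττ⟩, sub_eq_zero.2 h'⟩)
  exact absurd ht'.2 (not_lt.2 hle)

theorem mainTheorem6 (νstar : EReal) (H : ℝ → ℝ × ℝ → ℝ → ℝ) (ω : ℝ → ℝ) (γ : ℝ → ℝ × ℝ)
    (u s : ℝ → ℝ → ℝ × ℝ) (hfam : IsForcedFamily νstar H ω γ u s)
    (ν : ℝ) (hν : 0 < ν) (hν' : (ν : EReal) < νstar)
    (p q : ℝ × ℝ) (hpq : AreNeighbours (u ν) (s ν) (γ ν) p q)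
    (hbif : ∀ z ∈ openSegmentOf (u ν) p q, ¬ UndergoesPrimaryBifurcation (u ν) (s ν) (γ ν) z) :
    (openSegmentOf (u ν) p q ⊆ enclosedBy (regionBoundary (u ν) (s ν) (γ ν) p) ∨
      openSegmentOf (u ν) p q ∩ (regionBoundary (u ν) (s ν) (γ ν) p ∪
        enclosedBy (regionBoundary (u ν) (s ν) (γ ν) p)) = ∅) ∧
    transverseIntersection (u ν) p q (regionBoundary (u ν) (s ν) (γ ν) p) = ∅ ∧
    (openSegmentOf (s ν) q p ⊆ enclosedBy (regionBoundary (u ν) (s ν) (γ ν) q) ∨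
      openSegmentOf (s ν) q p ∩ (regionBoundary (u ν) (s ν) (γ ν) q ∪
        enclosedBy (regionBoundary (u ν) (s ν) (γ ν) q)) = ∅) ∧
    transverseIntersection (s ν) q p (regionBoundary (u ν) (s ν) (γ ν) q) = ∅ ∧
    transverseIntersection (u ν) p q (openSegmentOf (s ν) q p) = ∅ := by
  obtain ⟨huc, hu, hug, -⟩ := hfam.unstable ν hν hν'
  obtain ⟨hsc, hs, hsg, -⟩ := hfam.stable ν hν hν'
  generalize u ν = u at *
  generalize s ν = s at *
  generalize γ ν = g at *
  subst hug
  obtain ⟨⟨hpP, -⟩, ⟨hqP, -⟩, ⟨a, a', ha, haa, rfl, rfl⟩, hnbr⟩ := hpq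
  obtain ⟨b, hb : 0 < b, hp⟩ := hpP.2.1
  obtain ⟨b', hb' : 0 < b', hq⟩ := hqP.2.1
  have ha' : 0 < a' := ha.trans haa
  have hpp := (isPrimaryHomoclinic_iff hu hs hsg.symm ha hb hp.symm).1 hpP
  have hqq := (isPrimaryHomoclinic_iff hu hs hsg.symm ha' hb' hq.symm).1 hqP
  -- The order of `p` and `q` on the stable branch is the reverse of that on the unstable branch.
  have hbb : b' < b := by
    refine lt_of_le_of_ne (not_lt.1 fun h => hqq a ⟨ha, haa⟩ b ⟨hb, h⟩ hp.symm) ?_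
    rintro rfl
    exact haa.ne (hu ha.le ha'.le (hp.symm.trans hq))
  have hU : openSegmentOf u (u a) (u a') = u '' Ioo a a' := openSegmentOf_eq hu ha.le haa.le
  have hS : openSegmentOf s (u a') (u a) = s '' Ioo b' b := by
    rw [← hp, ← hq, openSegmentOf_eq hs hb'.le hbb.le]
  have hΓp : regionBoundary u s (u 0) (u a) = u '' Icc 0 a ∪ s '' Icc 0 b := by
    rw [regionBoundary, closedSegmentOf_eq hu le_rfl ha.le, ← hsg, ← hp,
      closedSegmentOf_eq hs le_rfl hb.le]
  have hΓq : regionBoundary u s (u 0) (u a') = u '' Icc 0 a' ∪ s '' Icc 0 b' := by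
    rw [regionBoundary, closedSegmentOf_eq hu le_rfl ha'.le, ← hsg, ← hq,
      closedSegmentOf_eq hs le_rfl hb'.le]
  -- A primary point on `U(p, q)` would be in `P` or be a bifurcation; both are excluded.
  have hno : ∀ t ∈ Ioo a a', ∀ τ, 0 < τ → u t = s τ →
      ∃ t' ∈ Ioo 0 t, ∃ τ' ∈ Ioo 0 τ, u t' = s τ' := by
    intro t ht τ hτ heq
    by_contra hcon
    have hprim : IsPrimaryHomoclinic u s (u 0) (u t) :=
      (isPrimaryHomoclinic_iff hu hs hsg.symm (ha.trans ht.1) hτ heq).2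
        fun t' ht' τ' hτ' h' => hcon ⟨t', ht', τ', hτ', h'⟩
    have hmem : u t ∈ openSegmentOf u (u a) (u a') := hU ▸ mem_image_of_mem u ht
    exact hbif _ hmem ⟨hprim, fun htr => hnbr _ ⟨hprim, htr⟩ hmem⟩
  have hrect := ne_of_no_primary_between hs huc hsc ha hb' hp.symm hpp hqq hno
  have hUS : ∀ t ∈ Ioo a a', ∀ τ ∈ Icc 0 b, u t ≠ s τ := by
    intro t ht τ hτ heq
    have ht0 : 0 < t := ha.trans ht.1
    rcases hτ.1.eq_or_lt with rfl | hτ0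
    · exact ht0.ne' (hu ht0.le self_mem_Ici (heq.trans hsg))
    rcases lt_trichotomy τ b' with h | rfl | h
    · exact hqq t ⟨ht0, ht.2⟩ τ ⟨hτ0, h⟩ heq
    · exact ht.2.ne (hu ht0.le ha'.le (heq.trans hq))
    rcases hτ.2.eq_or_lt with rfl | h'
    · exact ht.1.ne' (hu ht0.le ha.le (heq.trans hp))
    · exact hrect t ht τ ⟨h, h'⟩ heq
  have hSU : ∀ τ ∈ Ioo b' b, ∀ t ∈ Icc 0 a', u t ≠ s τ := by
    intro τ hτ t ht heq
    have hτ0 : 0 < τ := hb'.trans hτ.1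
    rcases ht.1.eq_or_lt with rfl | ht0
    · exact hτ0.ne' (hs hτ0.le self_mem_Ici (heq.symm.trans hsg.symm))
    rcases lt_trichotomy t a with h | rfl | h
    · exact hpp t ⟨ht0, h⟩ τ ⟨hτ0, hτ.2⟩ heq
    · exact hτ.2.ne (hs hτ0.le hb.le (heq.symm.trans hp.symm))
    rcases ht.2.eq_or_lt with rfl | h'
    · exact hτ.1.ne' (hs hτ0.le hb'.le (heq.symm.trans hq.symm))
    · exact hrect t ⟨h, h'⟩ τ hτ heq
  have hdisjU : Disjoint (openSegmentOf u (u a) (u a')) (regionBoundary u s (u 0) (u a)) := by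
    rw [hU, hΓp, disjoint_left]
    rintro _ ⟨t, ht, rfl⟩ (⟨t', ht', h⟩ | ⟨τ, hτ, h⟩)
    · have := hu ht'.1 (ha.trans ht.1).le h
      exact absurd ht.1 (not_lt.2 (this ▸ ht'.2))
    · exact hUS t ht τ hτ h.symm
  have hdisjS : Disjoint (openSegmentOf s (u a') (u a)) (regionBoundary u s (u 0) (u a')) := by
    rw [hS, hΓq, disjoint_left]
    rintro _ ⟨τ, hτ, rfl⟩ (⟨t, ht, h⟩ | ⟨τ', hτ', h⟩)
    · exact hSU τ hτ t ht h
    · have := hs hτ'.1 (hb'.trans hτ.1).le h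
      exact absurd hτ.1 (not_lt.2 (this ▸ hτ'.2))
  have hdisjUS : Disjoint (openSegmentOf u (u a) (u a')) (openSegmentOf s (u a') (u a)) := by
    rw [hU, hS, disjoint_left]
    rintro _ ⟨t, ht, rfl⟩ ⟨τ, hτ, h⟩
    exact hrect t ht τ hτ h.symm
  have hconnU : IsPreconnected (openSegmentOf u (u a) (u a')) :=
    hU ▸ isPreconnected_Ioo.image u (huc.mono fun t ht => (ha.trans ht.1).le)
  have hconnS : IsPreconnected (openSegmentOf s (u a') (u a)) :=
    hS ▸ isPreconnected_Ioo.image s (hsc.mono fun τ hτ => (hb'.trans hτ.1).le)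
  exact ⟨subset_enclosedBy_or_inter_eq_empty hconnU hdisjU,
    transverseIntersection_eq_empty hdisjU,
    subset_enclosedBy_or_inter_eq_empty hconnS hdisjS,
    transverseIntersection_eq_empty hdisjS,
    transverseIntersection_eq_empty hdisjUS⟩
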